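/- **Monotony of $\beta$.** *Model.* Fix rates $\mu,\gamma>0$. An episode has an exponential length $L$ of rate $\gamma$; auctions arrive according to an independent Poisson process of intensity $\mu$, at times $s_1<s_2<\dots$. The prices-to-beat $B_1,B_2,\dots\in[0,\infty]$ are i.i.d., independent of the rest, with $\mathbb P(B_i<x)=q(x)$ for all $x\ge 0$. A policy is a measurable map $\pi:[0,\infty)\to[0,\infty)$ from the time elapsed since the last win to a bid. Let $a_i$ be the elapsed time at the $i$-th auction: it increases at unit speed, starts from $\tau\ge 0$ at time $0$, and is reset to $0$ after each won auction; auction $i$ is won when $\pi(a_i)>B_i$. The expected payoff of $\pi$ in the environment $(k,q)$ started at $\tau$ is $$\mathcal U(k,q,\pi,\tau)=\mathbb E\Big[\sum_{i:\,s_i\le L}\big(k(a_i)-B_i\big)\,\mathbf 1[\pi(a_i)>B_i]\Big].$$ The Bellman value is $V^\star(\tau)=\sup_\pi \mathcal U(k,q,\pi,\tau)$. Denote by $\mathcal S(k,q)$ the policy $$\mathcal S(k,q)(\tau)=\max\big(0,\;k(\tau)+V^\star(0)-V^\star(\tau)\big),$$ and for a policy $\pi$ let $\beta(\pi)=\lim_{t\to\infty}\pi(t)$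 when this limit exists. *Classes.* Fix finite lists of breakpoints $0=t_0<\dots<t_m$ and $0=b_0<\dots<b_n$. Let $\mathcal K$ be the set of functions $k:[0,\infty)\to\mathbb R$ that are nondecreasing, concave, affine on each $[t_{i-1},t_i]$, and constant on $[t_m,\infty)$. Let $\mathcal Q$ be the set of functions $q:[0,\infty)\to[0,1]$ that are nondecreasing, affine on each $[b_{i-1},b_i]$ and on $[b_n,\infty)$, with $q(0)=0$. (If $\sup q<1$, the price-to-beat is $+\infty$ with the remaining probability.) *Theorem.* Let $k_1,k_2\in\mathcal K$ with $k_1\le k_2$ pointwise and $q_1,q_2\in\mathcal Q$ with $q_1\ge q_2$ pointwise. Then, for $i=1,2$, the policy $\mathcal S(k_i,q_i)$ is optimal in the environment $(k_i,q_i)$ (it maximizes $\mathcal U(k_i,q_i,\cdot,\tau)$ over all policies, for every $\tau\ge 0$) and the limit $\beta(\mathcal S(k_i,q_i))$ exists and is finite; moreover $$\beta(\mathcal S(k_1,q_1))\le\beta(\mathcal S(k_2,q_2)).$$ -/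

import Mathlib

open MeasureTheory ProbabilityTheory Filter Topology Set
open scoped NNReal ENNReal unitInterval

noncomputable section

namespace RepeatedAuction

/-- The known rates of the model: auctions arrive according to a Poisson process of intensity `μ`,
and an episode ends after an independent exponential time of rate `γ`. -/
structure Rates where
  μ : ℝ
  γ : ℝ
  μ_pos : 0 < μ
  γ_pos : 0 < γ

instance (r : Rates) : IsProbabilityMeasure (expMeasure r.μ) :=
  isProbabilityMeasure_expMeasure r.μ_pos

instance (r : Rates) : IsProbabilityMeasure (expMeasure r.γ) :=
  isProbabilityMeasure_expMeasure r.γ_pos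

/-! ### The primitives: mean reward `k` and win probability `q` -/

/-- `f` is (continuous and) affine on each of the intervals `[t 0, t 1], …, [t (m-1), t m]` and on
`[t m, ∞)`. -/
def IsPiecewiseLinear {m : ℕ} (t : Fin (m + 1) → ℝ≥0) (f : ℝ≥0 → ℝ) : Prop :=
  (∀ i : Fin m, ∃ a c : ℝ, ∀ x ∈ Icc (t i.castSucc) (t i.succ), f x = a * x + c) ∧
    ∃ a c : ℝ, ∀ x, t (Fin.last m) ≤ x → f x = a * x + c

/-- The reward functions: piecewise linear with finite breakpoints `t`, concave, increasing, and
with slope zero after the last finite breakpoint. -/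
def rewardClass {m : ℕ} (t : Fin (m + 1) → ℝ≥0) : Set (ℝ≥0 → ℝ) :=
  {k | IsPiecewiseLinear t k ∧ ConcaveOn ℝ≥0 univ k ∧ Monotone k ∧
    ∀ x, t (Fin.last m) ≤ x → k x = k (t (Fin.last m))}

/-- The win probabilities: piecewise linear with breakpoints `b`, increasing, vanishing at `0`, and
with values at most one. (A limit at infinity smaller than one is allowed; the price-to-beat is
then infinite with the remaining probability.) -/
def winProbClass {n : ℕ} (b : Fin (n + 1) → ℝ≥0) : Set (ℝ≥0 → ℝ) :=
  {q | IsPiecewiseLinear b q ∧ Monotone q ∧ q 0 = 0 ∧ ∀ x, q x ≤ 1}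

/-! ### One episode -/

/-- The randomness of an episode: its length, and for each auction the time elapsed since the
previous arrival and a uniform variable from which the price-to-beat is generated. -/
abbrev Sample : Type := ℝ × (ℕ → ℝ × I)

/-- The law of the randomness: everything is independent, the episode length is exponential with
rate `γ`, the interarrival times are exponential with rate `μ`, the rest is uniform on `[0, 1]`. -/
def episodeLaw (r : Rates) : Measure Sample :=
  (expMeasure r.γ).prod
    (Measure.infinitePi fun _ : ℕ => (expMeasure r.μ).prod (volume : Measure I))

/-- The price-to-beat, generated by inverting its distribution function `q`: for continuous `q`
with `q 0 = 0` one has `priceToBeat q u < x` iff `u < q x`, an event of probability `q x`. -/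
def priceToBeat (q : ℝ≥0 → ℝ) (u : I) : ℝ≥0∞ :=
  ⨅ (x : ℝ≥0) (_ : (u : ℝ) < q x), (x : ℝ≥0∞)

/-- The arrival time of the `n`-th auction (auctions are numbered from `0`). -/
def arrivalTime (ω : Sample) (n : ℕ) : ℝ := ∑ j ∈ Finset.range (n + 1), (ω.2 j).1

/-- The price-to-beat in the `n`-th auction. -/
def price (q : ℝ≥0 → ℝ) (ω : Sample) (n : ℕ) : ℝ≥0∞ := priceToBeat q (ω.2 n).2

open Classical in
/-- The time elapsed since the last win when the `n`-th auction takes place. A bidding policy `π`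
maps this time to a bid; the episode starts when the elapsed time is `τ`, and each win, that is
each bid above the price-to-beat, resets it to zero. -/
def age (q : ℝ≥0 → ℝ) (π : ℝ≥0 → ℝ≥0) (τ : ℝ≥0) (ω : Sample) : ℕ → ℝ≥0
  | 0 => τ + (ω.2 0).1.toNNReal
  | n + 1 =>
      (if price q ω n < π (age q π τ ω n) then 0 else age q π τ ω n) + (ω.2 (n + 1)).1.toNNReal

open Classical in
/-- The profit of an episode: the sum of reward minus payment over the auctions of the episode that
are won. Almost surely only finitely many terms are nonzero. -/
def episodeProfit (k q : ℝ≥0 → ℝ) (π : ℝ≥0 → ℝ≥0) (τ : ℝ≥0) (ω : Sample) : ℝ :=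
  ∑' n : ℕ,
    if arrivalTime ω n ≤ ω.1 ∧ price q ω n < π (age q π τ ω n) then
      k (age q π τ ω n) - (price q ω n).toReal
    else 0

/-! ### Values and optimal policies -/

/-- The expected payoff of the policy `π` in the environment `(k, q)`, starting at elapsed
time `τ`. -/
def expectedPayoff (r : Rates) (k q : ℝ≥0 → ℝ) (π : ℝ≥0 → ℝ≥0) (τ : ℝ≥0) : ℝ :=
  ∫ ω, episodeProfit k q π τ ω ∂(episodeLaw r)

/-- The Bellman value: the supremum of the expected payoff over all (measurable) policies. -/
def bellmanValue (r : Rates) (k q : ℝ≥0 → ℝ) (τ : ℝ≥0) : ℝ :=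
  ⨆ π : {π : ℝ≥0 → ℝ≥0 // Measurable π}, expectedPayoff r k q π τ

/-- The policy `π` is optimal, from every starting state. -/
def IsOptimalPolicy (r : Rates) (k q : ℝ≥0 → ℝ) (π : ℝ≥0 → ℝ≥0) : Prop :=
  Measurable π ∧
    ∀ π' : ℝ≥0 → ℝ≥0, Measurable π' → ∀ τ, expectedPayoff r k q π' τ ≤ expectedPayoff r k q π τ

/-- The policy `𝒮(k, q)`: bid `max (0, k τ + V 0 - V τ)` where `V` is the Bellman value. -/
def optimalBid (r : Rates) (k q : ℝ≥0 → ℝ) (τ : ℝ≥0) : ℝ≥0 :=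
  (k τ + bellmanValue r k q 0 - bellmanValue r k q τ).toNNReal

/-- The asymptotic bid `β(π)`, the limit of `π` at infinity. -/
def asymptoticBid (π : ℝ≥0 → ℝ≥0) : ℝ≥0 := limUnder atTop π

end RepeatedAuction

end

noncomputable section

namespace RepeatedAuction

open BoundedContinuousFunction

/-! ### The expected surplus at a given willingness to pay -/

/-! Write S(z) = E (z - B)⁺ (`meanSurplus`). Integrating out the exponential episode length replaces
survival up to time s by the discount exp(-γ s), which leaves a discounted Markov decision problem.
Its Bellman equation is V(τ) = E[exp(-γ s) (V(a) + S(w(a)))] with a = τ + s, s exponential of rate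
μ, and w = k + V(0) - V (`willingness`). As S is nondecreasing and 1-Lipschitz, the right side is a
contraction of factor μ/(μ+γ) in V (`contracting_bellman`). Telescoping the discounted values along
the process bounds the payoff of every policy by V, with equality for the bid w⁺
(`expectedPayoff_le`, `expectedPayoff_bellmanBid`). Hence V is the Bellman value and 𝒮(k, q) = w⁺.

Beyond the last breakpoint T the reward is constant, hence so is V (`value_eq_of_le`): the bid is
eventually w(T)⁺, and γ V(T) = μ S(w(T)) (`value_at_last`). The Bellman equation also gives V' = γ V
- μ S(w) (`hasDerivWithinAt_value`). With D = V - V(0), so that w = k - D, this reads D' = μ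
(S(w(T)) - S(w)) + γ (D - D(T)).

Suppose w₁(T) > w₂(T). Then D₁(T) < D₂(T), because k₁ ≤ k₂. Wherever D₁ = D₂, one has w₁ ≤ w₂ ≤
w₂(T) < w₁(T) (`willingness_le_last`), and the increment of S₁ from w₁ to w₁(T) dominates that of S₂
from w₂ to w₂(T) (`meanSurplus_sub_le`). So D₁' > D₂' at every contact point. Since D₁(0) = D₂(0) =
0, it follows that D₂ ≤ D₁ up to T, a contradiction (`willingness_last_mono`). -/

lemma measurable_priceToBeat (q : ℝ≥0 → ℝ) : Measurable (priceToBeat q) := by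
  refine Monotone.measurable fun u v huv => ?_
  have huv' : (u : ℝ) ≤ v := huv
  exact le_iInf₂ fun x hx => iInf₂_le x (huv'.trans_lt hx)

lemma priceToBeat_anti {q₁ q₂ : ℝ≥0 → ℝ} (h : ∀ x, q₂ x ≤ q₁ x) (u : I) :
    priceToBeat q₁ u ≤ priceToBeat q₂ u :=
  le_iInf₂ fun x hx => iInf₂_le x (hx.trans_le (h x))

open Classical in
/-- The surplus of a bidder with willingness to pay `z` who observes the price-to-beat. -/
def surplus (q : ℝ≥0 → ℝ) (z : ℝ) (u : I) : ℝ :=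
  -- The infinite price is treated apart because `toReal` sends it to 0, which would make an
  -- unwinnable auction free.
  if priceToBeat q u = ⊤ then 0 else max (z - (priceToBeat q u).toReal) 0

/-- The expected surplus of a bidder with willingness to pay `z`. -/
def meanSurplus (q : ℝ≥0 → ℝ) (z : ℝ) : ℝ := ∫ u, surplus q z u

variable {q : ℝ≥0 → ℝ}

lemma surplus_nonneg (z : ℝ) (u : I) : 0 ≤ surplus q z u := by
  unfold surplus; split_ifs <;> simp

lemma surplus_le (z : ℝ) (u : I) : surplus q z u ≤ max z 0 := by
  unfold surplus
  split_ifs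
  · simp
  · exact max_le_max (by simp) le_rfl

lemma surplus_mono (u : I) : Monotone fun z => surplus q z u := by
  intro z w h
  unfold surplus
  split_ifs
  · rfl
  · exact max_le_max (by linarith) le_rfl

lemma surplus_le_add {z w : ℝ} (h : z ≤ w) (u : I) : surplus q w u ≤ surplus q z u + (w - z) := by
  unfold surplus
  split_ifs
  · linarith
  · refine max_le ?_ ?_
    · linarith [le_max_left (z - (priceToBeat q u).toReal) 0]
    · linarith [le_max_right (z - (priceToBeat q u).toReal) 0]

lemma measurable_surplus_uncurry (q : ℝ≥0 → ℝ) :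
    Measurable fun p : ℝ × I => surplus q p.1 p.2 := by
  have hB : Measurable fun p : ℝ × I => priceToBeat q p.2 :=
    (measurable_priceToBeat q).comp measurable_snd
  exact Measurable.ite (hB (measurableSet_singleton ⊤)) measurable_const
    ((measurable_fst.sub hB.ennreal_toReal).max measurable_const)

lemma integrable_surplus (q : ℝ≥0 → ℝ) (z : ℝ) : Integrable (surplus q z) := by
  refine Integrable.of_bound (C := max z 0)
    ((measurable_surplus_uncurry q).comp measurable_prodMk_left).aestronglyMeasurable
    (ae_of_all _ fun u => ?_)
  rw [Real.norm_of_nonneg (surplus_nonneg z u)]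
  exact surplus_le z u

lemma meanSurplus_nonneg (z : ℝ) : 0 ≤ meanSurplus q z :=
  integral_nonneg fun u => surplus_nonneg z u

lemma meanSurplus_le (z : ℝ) : meanSurplus q z ≤ max z 0 := by
  have := integral_mono (integrable_surplus q z) (integrable_const (max z 0)) (surplus_le z)
  rw [integral_const, probReal_univ, one_smul] at this
  exact this

lemma meanSurplus_mono : Monotone (meanSurplus q) := fun z w h =>
  integral_mono (integrable_surplus q z) (integrable_surplus q w) fun u => surplus_mono u h

lemma meanSurplus_le_add {z w : ℝ} (h : z ≤ w) : meanSurplus q w ≤ meanSurplus q z + (w - z) := by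
  have := integral_mono (integrable_surplus q w)
    ((integrable_surplus q z).add (integrable_const (w - z))) (surplus_le_add h)
  rw [integral_add' (integrable_surplus q z) (integrable_const _)] at this
  rw [integral_const, probReal_univ, one_smul] at this
  exact this

lemma continuous_meanSurplus (q : ℝ≥0 → ℝ) : Continuous (meanSurplus q) := by
  refine (LipschitzWith.of_le_add fun w z => ?_).continuous
  rcases le_total z w with h | h
  · exact (meanSurplus_le_add h).trans (by rw [Real.dist_eq, abs_of_nonneg (by linarith)])
  · exact (meanSurplus_mono h).trans (by linarith [dist_nonneg (x := w) (y := z)])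

/-- Increments of the expected surplus are larger when the prices are lower and when the interval
is larger. -/
lemma meanSurplus_sub_le {q₁ q₂ : ℝ≥0 → ℝ} (hq : ∀ x, q₂ x ≤ q₁ x) {u₁ u₂ v₁ v₂ : ℝ}
    (hu : u₁ ≤ u₂) (huv : u₂ ≤ v₂) (hv : v₂ ≤ v₁) :
    meanSurplus q₂ v₂ - meanSurplus q₂ u₂ ≤ meanSurplus q₁ v₁ - meanSurplus q₁ u₁ := by
  unfold meanSurplus
  rw [← integral_sub (integrable_surplus _ _) (integrable_surplus _ _),
    ← integral_sub (integrable_surplus _ _) (integrable_surplus _ _)]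
  refine integral_mono ((integrable_surplus _ _).sub (integrable_surplus _ _))
    ((integrable_surplus _ _).sub (integrable_surplus _ _)) fun u => ?_
  -- Enlarging the interval only helps, so the comparison reduces to the common interval from u₂ to
  -- v₂. There both prices come from the same uniform variable, hence are ordered pointwise, and (v
  -- - B)⁺ - (u - B)⁺ is nonincreasing in B.
  have hm : surplus q₁ u₁ u ≤ surplus q₁ u₂ u := surplus_mono u hu
  have hM : surplus q₁ v₂ u ≤ surplus q₁ v₁ u := surplus_mono u hv
  have h0 : surplus q₁ u₂ u ≤ surplus q₁ v₂ u := surplus_mono u huv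
  suffices surplus q₂ v₂ u - surplus q₂ u₂ u ≤ surplus q₁ v₂ u - surplus q₁ u₂ u by
    simp only; linarith
  have hB := priceToBeat_anti hq u
  by_cases h2 : priceToBeat q₂ u = ⊤
  · simpa [surplus, h2] using h0
  have h1 : priceToBeat q₁ u ≠ ⊤ := ne_top_of_le_ne_top h2 hB
  have hr := ENNReal.toReal_mono h2 hB
  simp only [surplus, h1, h2, if_false]
  grind

/-- The optimal value of an auction, when `z` is the reward, `w` the value after a win and `v` the
value after a loss, is monotone in the values. -/
lemma add_meanSurplus_le {z v v' w w' : ℝ} (hv : v ≤ v') (hw : w ≤ w') :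
    v + meanSurplus q (z + w - v) ≤ v' + meanSurplus q (z + w' - v') := by
  -- Raising v costs the surplus at most the amount gained, by the 1-Lipschitz bound.
  have h1 : meanSurplus q (z + w - v) ≤ meanSurplus q (z + w - v') + (v' - v) := by
    have := meanSurplus_le_add (q := q) (z := z + w - v') (w := z + w - v) (by linarith)
    linarith
  have h2 : meanSurplus q (z + w - v') ≤ meanSurplus q (z + w' - v') :=
    meanSurplus_mono (by linarith)
  linarith

/-! ### Exponential variables -/

lemma integral_expMeasure {c : ℝ} (hc : 0 < c) (f : ℝ → ℝ) :
    ∫ s, f s ∂(expMeasure c) = ∫ s in Ioi 0, c * Real.exp (-(c * s)) * f s := by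
  have h : expMeasure c = volume.withDensity (exponentialPDF c) := rfl
  rw [h, integral_withDensity_eq_integral_toReal_smul, ← integral_Ici_eq_integral_Ioi,
    ← integral_indicator measurableSet_Ici]
  · refine integral_congr_ae (ae_of_all _ fun s => ?_)
    by_cases hs : 0 ≤ s
    · simp only [exponentialPDF_of_nonneg hs, Set.indicator, mem_Ici, hs, if_true, smul_eq_mul]
      rw [ENNReal.toReal_ofReal (by positivity)]
    · simp [exponentialPDF_of_neg (not_le.1 hs), Set.indicator, hs]
  · exact (measurable_exponentialPDFReal c).ennreal_ofReal
  · exact ae_of_all _ fun s => ENNReal.ofReal_lt_top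

/-- The expected discount over one interarrival time. -/
lemma integral_discount (r : Rates) :
    ∫ s, Real.exp (-(r.γ * s.toNNReal)) ∂(expMeasure r.μ) = r.μ / (r.μ + r.γ) := by
  have hμ := r.μ_pos
  have hγ := r.γ_pos
  rw [integral_expMeasure r.μ_pos]
  have : ∀ s ∈ Ioi (0 : ℝ), r.μ * Real.exp (-(r.μ * s)) * Real.exp (-(r.γ * s.toNNReal)) =
      r.μ * Real.exp (-(r.μ + r.γ) * s) := by
    intro s hs
    rw [Real.coe_toNNReal _ (le_of_lt hs), mul_assoc, ← Real.exp_add]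
    ring_nf
  rw [setIntegral_congr_fun measurableSet_Ioi this, integral_const_mul,
    integral_exp_mul_Ioi (by linarith)]
  simp only [mul_zero, Real.exp_zero]
  field_simp

/-- The probability that an exponential variable exceeds a given nonnegative number. -/
lemma measureReal_expMeasure_Ici {c x : ℝ} (hc : 0 < c) (hx : 0 ≤ x) :
    (expMeasure c).real (Ici x) = Real.exp (-(c * x)) := by
  have h := integral_expMeasure hc ((Ici x).indicator 1)
  rw [integral_indicator_one measurableSet_Ici] at h
  have h2 : (fun s => c * Real.exp (-(c * s)) * (Ici x).indicator (1 : ℝ → ℝ) s) =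
      (Ici x).indicator fun s => c * Real.exp (-c * s) := by
    funext s
    by_cases hs : s ∈ Ici x <;> simp [hs]
  rw [h, h2, ← integral_Ici_eq_integral_Ioi, setIntegral_indicator measurableSet_Ici, Ici_inter_Ici,
    sup_of_le_right hx, integral_const_mul, integral_Ici_eq_integral_Ioi,
    integral_exp_mul_Ioi (by linarith)]
  field_simp

lemma ae_nonneg_expMeasure (c : ℝ) : ∀ᵐ s ∂(expMeasure c), 0 ≤ s := by
  have h : expMeasure c = volume.withDensity (exponentialPDF c) := rfl
  rw [h, ae_withDensity_iff (f := exponentialPDF c)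
    (measurable_exponentialPDFReal c).ennreal_ofReal]
  refine ae_of_all _ fun s hs => ?_
  by_contra hn
  exact hs (exponentialPDF_of_neg (not_le.1 hn))

lemma integrable_discount_mul (r : Rates) {f : ℝ → ℝ} (hf : Measurable f) {C : ℝ}
    (hC : ∀ s, |f s| ≤ C) :
    Integrable (fun s => Real.exp (-(r.γ * s.toNNReal)) * f s) (expMeasure r.μ) := by
  have hm : Measurable fun s : ℝ => Real.exp (-(r.γ * s.toNNReal)) := by fun_prop
  refine Integrable.of_bound (C := C) (hm.mul hf).aestronglyMeasurable (ae_of_all _ fun s => ?_)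
  rw [norm_mul, Real.norm_eq_abs, Real.norm_eq_abs, Real.abs_exp]
  have h1 : Real.exp (-(r.γ * s.toNNReal)) ≤ 1 := by
    rw [Real.exp_le_one_iff]
    have := mul_nonneg r.γ_pos.le s.toNNReal.coe_nonneg
    linarith
  calc _ ≤ 1 * |f s| := by gcongr
    _ ≤ C := by rw [one_mul]; exact hC s

/-! ### The Bellman operator -/

/-- The optimal value of an auction held at elapsed time `a`, given the continuation values `V`. -/
def auctionValue (k : ℝ≥0 →ᵇ ℝ) (q : ℝ≥0 → ℝ) (V : ℝ≥0 →ᵇ ℝ) : ℝ≥0 →ᵇ ℝ :=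
  BoundedContinuousFunction.ofNormedAddCommGroup
    (fun a => V a + meanSurplus q (k a + V 0 - V a))
    (V.continuous.add ((continuous_meanSurplus q).comp
      ((k.continuous.add continuous_const).sub V.continuous)))
    (‖V‖ + (‖k‖ + ‖V‖ + ‖V‖)) fun a => by
      have h1 := abs_le.1 (V.norm_coe_le_norm a)
      have h2 := abs_le.1 (V.norm_coe_le_norm 0)
      have h3 := abs_le.1 (k.norm_coe_le_norm a)
      refine (norm_add_le _ _).trans (add_le_add (V.norm_coe_le_norm a) ?_)
      rw [Real.norm_of_nonneg (meanSurplus_nonneg _)]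
      refine (meanSurplus_le _).trans (max_le (by linarith) (by positivity))

lemma auctionValue_apply (k : ℝ≥0 →ᵇ ℝ) (q : ℝ≥0 → ℝ) (V : ℝ≥0 →ᵇ ℝ) (a : ℝ≥0) :
    auctionValue k q V a = V a + meanSurplus q (k a + V 0 - V a) := rfl

/-- The expected discounted value at the next auction. -/
def discounted (r : Rates) (g : ℝ≥0 →ᵇ ℝ) : ℝ≥0 →ᵇ ℝ :=
  BoundedContinuousFunction.ofNormedAddCommGroup
    (fun τ => ∫ s, Real.exp (-(r.γ * s.toNNReal)) * g (τ + s.toNNReal) ∂(expMeasure r.μ))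
    (continuous_of_dominated (bound := fun s => Real.exp (-(r.γ * s.toNNReal)) * ‖g‖)
      (fun τ => (by fun_prop : Continuous fun s : ℝ =>
        Real.exp (-(r.γ * s.toNNReal)) * g (τ + s.toNNReal)).aestronglyMeasurable)
      (fun τ => ae_of_all _ fun s => by
        rw [norm_mul, Real.norm_eq_abs, Real.abs_exp]
        exact mul_le_mul_of_nonneg_left (g.norm_coe_le_norm _) (Real.exp_nonneg _))
      (integrable_discount_mul r measurable_const fun _ => le_rfl)
      (ae_of_all _ fun s => by fun_prop))
    (r.μ / (r.μ + r.γ) * ‖g‖) fun τ => by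
      rw [← integral_discount, ← integral_mul_const]
      refine norm_integral_le_of_norm_le (integrable_discount_mul r measurable_const fun _ => le_rfl)
        (ae_of_all _ fun s => ?_)
      rw [norm_mul, Real.norm_eq_abs, Real.abs_exp]
      exact mul_le_mul_of_nonneg_left (g.norm_coe_le_norm _) (Real.exp_nonneg _)

lemma discounted_apply (r : Rates) (g : ℝ≥0 →ᵇ ℝ) (τ : ℝ≥0) :
    discounted r g τ =
      ∫ s, Real.exp (-(r.γ * s.toNNReal)) * g (τ + s.toNNReal) ∂(expMeasure r.μ) := rfl

lemma integrable_discounted (r : Rates) (g : ℝ≥0 →ᵇ ℝ) (τ : ℝ≥0) :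
    Integrable (fun s => Real.exp (-(r.γ * s.toNNReal)) * g (τ + s.toNNReal)) (expMeasure r.μ) :=
  integrable_discount_mul r (by fun_prop : Continuous fun s : ℝ => g (τ + s.toNNReal)).measurable
    fun _ => g.norm_coe_le_norm _

/-- If `g` exceeds `h` by at most `δ` after the respective elapsed times, then so do the discounted
values, by at most the discounted `δ`. -/
lemma discounted_le_add (r : Rates) {g h : ℝ≥0 →ᵇ ℝ} {x y : ℝ≥0} {δ : ℝ}
    (H : ∀ s : ℝ≥0, g (x + s) ≤ h (y + s) + δ) :
    discounted r g x ≤ discounted r h y + r.μ / (r.μ + r.γ) * δ := by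
  have hi : Integrable (fun s : ℝ => Real.exp (-(r.γ * s.toNNReal)) * δ) (expMeasure r.μ) :=
    integrable_discount_mul r measurable_const fun _ => le_rfl
  rw [← integral_discount, ← integral_mul_const, discounted_apply, discounted_apply,
    ← integral_add (integrable_discounted r h y) hi]
  refine integral_mono (integrable_discounted r g x)
    ((integrable_discounted r h y).add hi) fun s => ?_
  simp only
  rw [← mul_add]
  exact mul_le_mul_of_nonneg_left (H _) (Real.exp_nonneg _)

lemma contraction_factor_lt_one (r : Rates) : r.μ / (r.μ + r.γ) < 1 := by
  rw [div_lt_one (add_pos r.μ_pos r.γ_pos)]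
  linarith [r.γ_pos]

lemma contraction_factor_nonneg (r : Rates) : 0 ≤ r.μ / (r.μ + r.γ) :=
  (div_pos r.μ_pos (add_pos r.μ_pos r.γ_pos)).le

/-- A constant added to the continuation values shifts win and loss alike and leaves the willingness
to pay unchanged; monotonicity does the rest. -/
lemma auctionValue_le_add (k : ℝ≥0 →ᵇ ℝ) (q : ℝ≥0 → ℝ) {V W : ℝ≥0 →ᵇ ℝ} {δ : ℝ}
    (H : ∀ x, V x ≤ W x + δ) (x : ℝ≥0) :
    auctionValue k q V x ≤ auctionValue k q W x + δ := by
  rw [auctionValue_apply, auctionValue_apply]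
  have := add_meanSurplus_le (q := q) (z := k x) (H x) (H 0)
  have e : k x + (W 0 + δ) - (W x + δ) = k x + W 0 - W x := by ring
  rw [e] at this
  linarith

/-- Blackwell's criterion: the auction step is monotone and commutes with constants, and discounting
shrinks constants by μ/(μ+γ). -/
lemma contracting_bellman (r : Rates) (k : ℝ≥0 →ᵇ ℝ) (q : ℝ≥0 → ℝ) :
    ContractingWith ⟨r.μ / (r.μ + r.γ), contraction_factor_nonneg r⟩
      fun V => discounted r (auctionValue k q V) := by
  refine ⟨contraction_factor_lt_one r, LipschitzWith.of_dist_le_mul fun V W => ?_⟩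
  have key : ∀ V W : ℝ≥0 →ᵇ ℝ, ∀ x, discounted r (auctionValue k q V) x ≤
      discounted r (auctionValue k q W) x + r.μ / (r.μ + r.γ) * dist V W := by
    refine fun V W x => discounted_le_add r fun s => auctionValue_le_add k q (fun y => ?_) _
    have h := BoundedContinuousFunction.dist_coe_le_dist (f := V) (g := W) y
    rw [Real.dist_eq] at h
    have := le_of_abs_le h
    linarith
  refine (BoundedContinuousFunction.dist_le
    (mul_nonneg (contraction_factor_nonneg r) dist_nonneg)).2 fun x => ?_
  rw [Real.dist_eq, abs_sub_le_iff]
  have h1 := key V W x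
  have h2 := key W V x
  rw [dist_comm W V] at h2
  constructor
  · exact sub_le_iff_le_add'.2 h1
  · exact sub_le_iff_le_add'.2 h2

/-- The solution of the Bellman equation. -/
def bellmanSolution (r : Rates) (k : ℝ≥0 →ᵇ ℝ) (q : ℝ≥0 → ℝ) : ℝ≥0 →ᵇ ℝ :=
  (contracting_bellman r k q).fixedPoint

lemma bellmanSolution_eq (r : Rates) (k : ℝ≥0 →ᵇ ℝ) (q : ℝ≥0 → ℝ) :
    discounted r (auctionValue k q (bellmanSolution r k q)) = bellmanSolution r k q :=
  (contracting_bellman r k q).fixedPoint_isFixedPt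

/-! ### The controlled process -/

open Classical in
/-- The elapsed time right after an auction, as a function of the elapsed time `y` right after the
previous one and of the interarrival time and the price in `e`. -/
def nextState (q : ℝ≥0 → ℝ) (π : ℝ≥0 → ℝ≥0) (y : ℝ≥0) (e : ℝ × I) : ℝ≥0 :=
  if priceToBeat q e.2 < π (y + e.1.toNNReal) then 0 else y + e.1.toNNReal

open Classical in
/-- The profit made in an auction. -/
def auctionProfit (k q : ℝ≥0 → ℝ) (π : ℝ≥0 → ℝ≥0) (y : ℝ≥0) (e : ℝ × I) : ℝ :=
  if priceToBeat q e.2 < π (y + e.1.toNNReal) then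
    k (y + e.1.toNNReal) - (priceToBeat q e.2).toReal else 0

/-- The elapsed time right after the `n`-th auction (counted from `1`). -/
def state (q : ℝ≥0 → ℝ) (π : ℝ≥0 → ℝ≥0) (τ : ℝ≥0) (x : ℕ → ℝ × I) : ℕ → ℝ≥0
  | 0 => τ
  | n + 1 => nextState q π (state q π τ x n) (x n)

/-- The discount up to the `n`-th auction (counted from `1`). -/
def discountFactor (r : Rates) (x : ℕ → ℝ × I) : ℕ → ℝ
  | 0 => 1
  | n + 1 => discountFactor r x n * Real.exp (-(r.γ * (x n).1.toNNReal))

/-- The law of one interarrival time and the corresponding uniform variable. -/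
abbrev auctionLaw (r : Rates) : Measure (ℝ × I) := (expMeasure r.μ).prod volume

/-- The law of the sequence of interarrival times and uniform variables. -/
abbrev sequenceLaw (r : Rates) : Measure (ℕ → ℝ × I) := Measure.infinitePi fun _ => auctionLaw r

section process

variable {r : Rates} {q : ℝ≥0 → ℝ} {π : ℝ≥0 → ℝ≥0} {τ : ℝ≥0}

/-- Recording the elapsed time just after each auction, rather than at it, gives a Markov chain
driven by the i.i.d. pairs of interarrival time and uniform variable. -/
lemma age_eq_state (ω : Sample) (n : ℕ) :
    age q π τ ω n = state q π τ ω.2 n + (ω.2 n).1.toNNReal := by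
  induction n with
  | zero => rfl
  | succ n ih => simp only [age, ih, state, nextState, price]

lemma measurableSet_win (q : ℝ≥0 → ℝ) (hπ : Measurable π) :
    MeasurableSet {p : ℝ≥0 × (ℝ × I) | priceToBeat q p.2.2 < π (p.1 + p.2.1.toNNReal)} := by
  refine measurableSet_lt ((measurable_priceToBeat q).comp (by fun_prop)) ?_
  exact (hπ.comp (by fun_prop)).coe_nnreal_ennreal

lemma measurable_nextState (q : ℝ≥0 → ℝ) (hπ : Measurable π) :
    Measurable fun p : ℝ≥0 × (ℝ × I) => nextState q π p.1 p.2 :=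
  Measurable.ite (measurableSet_win q hπ) measurable_const (by fun_prop)

lemma measurable_auctionProfit {k : ℝ≥0 → ℝ} (hk : Measurable k) (q : ℝ≥0 → ℝ)
    (hπ : Measurable π) :
    Measurable fun p : ℝ≥0 × (ℝ × I) => auctionProfit k q π p.1 p.2 := by
  refine Measurable.ite (measurableSet_win q hπ) (Measurable.sub (hk.comp (by fun_prop)) ?_)
    measurable_const
  exact ((measurable_priceToBeat q).comp (by fun_prop)).ennreal_toReal

lemma measurable_state (q : ℝ≥0 → ℝ) (hπ : Measurable π) (τ : ℝ≥0) (n : ℕ) :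
    Measurable fun x => state q π τ x n := by
  induction n with
  | zero => exact measurable_const
  | succ n ih =>
    have h : Measurable fun x => (state q π τ x n, x n) := ih.prodMk (measurable_pi_apply n)
    have h' := (measurable_nextState q hπ).comp h
    simpa only [state, Function.comp_def] using h'

lemma measurable_discountFactor (r : Rates) (n : ℕ) :
    Measurable fun x => discountFactor r x n := by
  induction n with
  | zero => exact measurable_const
  | succ n ih =>
    refine ih.mul ?_
    fun_prop

lemma discountFactor_nonneg (r : Rates) (x : ℕ → ℝ × I) (n : ℕ) : 0 ≤ discountFactor r x n := by
  induction n with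
  | zero => exact zero_le_one
  | succ n ih => exact mul_nonneg ih (Real.exp_nonneg _)

lemma exp_discount_le_one (r : Rates) (s : ℝ≥0) : Real.exp (-(r.γ * s)) ≤ 1 := by
  rw [Real.exp_le_one_iff]
  have := mul_nonneg r.γ_pos.le s.coe_nonneg
  linarith

lemma discountFactor_le_one (r : Rates) (x : ℕ → ℝ × I) (n : ℕ) : discountFactor r x n ≤ 1 := by
  induction n with
  | zero => exact le_rfl
  | succ n ih => exact mul_le_one₀ ih (Real.exp_nonneg _) (exp_discount_le_one r _)

lemma state_congr {x y : ℕ → ℝ × I} {n : ℕ} (h : ∀ i < n, x i = y i) :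
    state q π τ x n = state q π τ y n := by
  induction n with
  | zero => rfl
  | succ n ih =>
    simp only [state]
    rw [ih fun i hi => h i (hi.trans n.lt_succ_self), h n n.lt_succ_self]

lemma discountFactor_congr {x y : ℕ → ℝ × I} {n : ℕ} (h : ∀ i < n, x i = y i) :
    discountFactor r x n = discountFactor r y n := by
  induction n with
  | zero => rfl
  | succ n ih =>
    simp only [discountFactor]
    rw [ih fun i hi => h i (hi.trans n.lt_succ_self), h n n.lt_succ_self]

/-- The past before an auction is independent of the auction. -/
lemma indepFun_past (r : Rates) (q : ℝ≥0 → ℝ) (hπ : Measurable π) (τ : ℝ≥0) (n : ℕ) :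
    IndepFun (fun x => (discountFactor r x n, state q π τ x n)) (fun x => x n)
      (sequenceLaw r) := by
  have hi : iIndepFun (fun (i : ℕ) (x : ℕ → ℝ × I) => x i) (sequenceLaw r) :=
    iIndepFun_infinitePi (P := fun _ => auctionLaw r) (X := fun _ e => e) fun _ => measurable_id
  have h2 := hi.indepFun_finset (Finset.range n) {n} (by simp) fun i => measurable_pi_apply i
  -- Padding with an arbitrary value exhibits the past as a function of the first n coordinates
  -- alone.
  let ext : ((i : Finset.range n) → ℝ × I) → ℕ → ℝ × I :=
    fun z i => if h : i ∈ Finset.range n then z ⟨i, h⟩ else (0, 0)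
  have hext : Measurable ext := by
    refine measurable_pi_lambda _ fun i => ?_
    by_cases h : i ∈ Finset.range n
    · simpa only [ext, h, dif_pos] using measurable_pi_apply (⟨i, h⟩ : Finset.range n)
    · simpa only [ext, h, dif_neg, not_false_eq_true] using measurable_const
  have hev : Measurable fun z : ((i : ({n} : Finset ℕ)) → ℝ × I) => z ⟨n, by simp⟩ :=
    measurable_pi_apply _
  have h3 := h2.comp (φ := fun z => (discountFactor r (ext z) n, state q π τ (ext z) n))
    (ψ := fun z => z ⟨n, by simp⟩)
    (((measurable_discountFactor r n).prodMk (measurable_state q hπ τ n)).comp hext)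
    hev
  refine h3.congr (ae_of_all _ fun x => ?_) (ae_of_all _ fun x => rfl)
  symm
  have hx : ∀ i < n, x i = ext (fun j : Finset.range n => x j) i := by
    intro i hi
    simp [ext, hi]
  exact Prod.ext (discountFactor_congr hx) (state_congr hx)

/-- Integrating out the `n`-th auction given the past. -/
lemma integral_discountFactor_mul (r : Rates) (q : ℝ≥0 → ℝ) (hπ : Measurable π) (τ : ℝ≥0) (n : ℕ)
    {F : ℝ≥0 × (ℝ × I) → ℝ} (hF : Measurable F) {C : ℝ} (hC : ∀ p, |F p| ≤ C) :
    ∫ x, discountFactor r x n * F (state q π τ x n, x n) ∂(sequenceLaw r) =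
      ∫ x, discountFactor r x n * ∫ e, F (state q π τ x n, e) ∂(auctionLaw r)
        ∂(sequenceLaw r) := by
  have hP : Measurable fun x => (discountFactor r x n, state q π τ x n) :=
    (measurable_discountFactor r n).prodMk (measurable_state q hπ τ n)
  have hn : Measurable fun x : ℕ → ℝ × I => x n := measurable_pi_apply n
  have hmap := (indepFun_iff_map_prod_eq_prod_map_map hP.aemeasurable hn.aemeasurable).1
    (indepFun_past r q hπ τ n)
  have hev : (sequenceLaw r).map (fun x => x n) = auctionLaw r :=
    Measure.infinitePi_map_eval (μ := fun _ : ℕ => auctionLaw r) n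
  rw [hev] at hmap
  have hG : Measurable fun p : (ℝ × ℝ≥0) × (ℝ × I) => p.1.1 * F (p.1.2, p.2) :=
    (by fun_prop : Measurable fun p : (ℝ × ℝ≥0) × (ℝ × I) => p.1.1).mul
      (hF.comp (by fun_prop))
  have : IsProbabilityMeasure ((sequenceLaw r).map
      fun x => (discountFactor r x n, state q π τ x n)) :=
    Measure.isProbabilityMeasure_map hP.aemeasurable
  have h1 := integral_map (μ := sequenceLaw r) (hP.prodMk hn).aemeasurable
    hG.aestronglyMeasurable
  have hint : Integrable (fun p : (ℝ × ℝ≥0) × (ℝ × I) => p.1.1 * F (p.1.2, p.2))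
      (((sequenceLaw r).map fun x => (discountFactor r x n, state q π τ x n)).prod
        (auctionLaw r)) := by
    rw [← hmap, integrable_map_measure hG.aestronglyMeasurable (hP.prodMk hn).aemeasurable]
    refine Integrable.of_bound (C := C) (hG.comp (hP.prodMk hn)).aestronglyMeasurable
      (ae_of_all _ fun x => ?_)
    simp only [Function.comp, norm_mul, Real.norm_eq_abs]
    rw [abs_of_nonneg (discountFactor_nonneg r x n)]
    calc _ ≤ 1 * |F (state q π τ x n, x n)| := by gcongr; exact discountFactor_le_one r x n
      _ ≤ C := by rw [one_mul]; exact hC _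
  rw [hmap, integral_prod _ hint, integral_map hP.aemeasurable] at h1
  · rw [← h1]
    simp only [integral_const_mul]
  · exact hint.aestronglyMeasurable.integral_prod_right'

lemma integrable_discountFactor_mul (r : Rates) (n : ℕ) {g : (ℕ → ℝ × I) → ℝ} (hg : Measurable g)
    {C : ℝ} (hC : ∀ x, |g x| ≤ C) :
    Integrable (fun x => discountFactor r x n * g x) (sequenceLaw r) := by
  refine Integrable.of_bound (C := C) ((measurable_discountFactor r n).mul hg).aestronglyMeasurable
    (ae_of_all _ fun x => ?_)
  rw [norm_mul, Real.norm_eq_abs, Real.norm_eq_abs, abs_of_nonneg (discountFactor_nonneg r x n)]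
  calc _ ≤ 1 * |g x| := by gcongr; exact discountFactor_le_one r x n
    _ ≤ C := by rw [one_mul]; exact hC _

lemma integral_discountFactor (r : Rates) (n : ℕ) :
    ∫ x, discountFactor r x n ∂(sequenceLaw r) = (r.μ / (r.μ + r.γ)) ^ n := by
  induction n with
  | zero => simp [discountFactor]
  | succ n ih =>
    have hF : Measurable fun p : ℝ≥0 × (ℝ × I) => Real.exp (-(r.γ * p.2.1.toNNReal)) := by fun_prop
    -- The discount does not involve the policy, so any price distribution, policy and starting
    -- state will do here.
    have h := integral_discountFactor_mul r (fun _ => 0) (π := fun _ => 0) measurable_const 0 n hF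
      (C := 1) fun p => by rw [Real.abs_exp]; exact exp_discount_le_one r _
    have hd : ∫ e, Real.exp (-(r.γ * e.1.toNNReal)) ∂(auctionLaw r) = r.μ / (r.μ + r.γ) := by
      rw [auctionLaw, integral_fun_fst (fun s : ℝ => Real.exp (-(r.γ * s.toNNReal))),
        integral_discount]
      simp
    simp only [hd] at h
    simp only [discountFactor]
    rw [h, integral_mul_const, ih, pow_succ]

end process

/-! ### Verification -/

/-- The policy that bids the reward plus the value of a win minus the value of a loss. -/
def bellmanBid (k V : ℝ≥0 →ᵇ ℝ) (τ : ℝ≥0) : ℝ≥0 := (k τ + V 0 - V τ).toNNReal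

section verification

variable {r : Rates} {k : ℝ≥0 →ᵇ ℝ} {q : ℝ≥0 → ℝ} {π : ℝ≥0 → ℝ≥0} {τ : ℝ≥0} {B : ℝ}

lemma measurable_bellmanBid (k V : ℝ≥0 →ᵇ ℝ) : Measurable (bellmanBid k V) :=
  (by unfold bellmanBid; fun_prop : Continuous (bellmanBid k V)).measurable

/-- Relative to losing, a win at price B gains w - B, so no decision beats knowing the price and
taking (w - B)⁺. -/
lemma auctionProfit_add_le (V : ℝ≥0 →ᵇ ℝ) (y : ℝ≥0) (e : ℝ × I) :
    auctionProfit k q π y e + V (nextState q π y e) ≤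
      V (y + e.1.toNNReal) +
        surplus q (k (y + e.1.toNNReal) + V 0 - V (y + e.1.toNNReal)) e.2 := by
  unfold auctionProfit nextState
  split_ifs with h
  · have hB : priceToBeat q e.2 ≠ ⊤ := h.ne_top
    have := le_max_left (k (y + e.1.toNNReal) + V 0 - V (y + e.1.toNNReal) -
      (priceToBeat q e.2).toReal) 0
    simp only [surplus, hB, if_false]
    linarith
  · have := surplus_nonneg (q := q) (k (y + e.1.toNNReal) + V 0 - V (y + e.1.toNNReal)) e.2
    linarith

/-- The bid w⁺ wins exactly when B < w, so it attains (w - B)⁺ without seeing the price. -/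
lemma auctionProfit_add_eq (V : ℝ≥0 →ᵇ ℝ) (y : ℝ≥0) (e : ℝ × I) :
    auctionProfit k q (bellmanBid k V) y e + V (nextState q (bellmanBid k V) y e) =
      V (y + e.1.toNNReal) +
        surplus q (k (y + e.1.toNNReal) + V 0 - V (y + e.1.toNNReal)) e.2 := by
  unfold auctionProfit nextState bellmanBid
  set a := y + e.1.toNNReal
  by_cases hB : priceToBeat q e.2 = ⊤
  · simp [surplus, hB]
  have hiff : priceToBeat q e.2 < ((k a + V 0 - V a).toNNReal : ℝ≥0∞) ↔
      (priceToBeat q e.2).toReal < k a + V 0 - V a := by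
    rw [← ENNReal.ofReal, ENNReal.lt_ofReal_iff_toReal_lt hB]
  simp only [surplus, hB, if_false, hiff]
  split_ifs with h
  · rw [max_eq_left (by linarith)]; ring
  · rw [max_eq_right (by linarith)]; ring

lemma abs_auctionProfit_le (hB : ∀ u, (priceToBeat q u).toReal ≤ B) (y : ℝ≥0) (e : ℝ × I) :
    |auctionProfit k q π y e| ≤ ‖k‖ + B := by
  have h0 : 0 ≤ (priceToBeat q e.2).toReal := ENNReal.toReal_nonneg
  have h1 := abs_le.1 (k.norm_coe_le_norm (y + e.1.toNNReal))
  have := hB e.2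
  have := norm_nonneg k
  unfold auctionProfit
  rw [abs_le]
  split_ifs <;> constructor <;> linarith

lemma integrable_auctionLaw_discount (r : Rates) {f : ℝ × I → ℝ} (hf : Measurable f) {C : ℝ}
    (hC : ∀ e, |f e| ≤ C) :
    Integrable (fun e => Real.exp (-(r.γ * e.1.toNNReal)) * f e) (auctionLaw r) := by
  have hm : Measurable fun e : ℝ × I => Real.exp (-(r.γ * e.1.toNNReal)) := by fun_prop
  refine Integrable.of_bound (C := C) (hm.mul hf).aestronglyMeasurable (ae_of_all _ fun e => ?_)
  rw [norm_mul, Real.norm_eq_abs, Real.norm_eq_abs, Real.abs_exp]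
  calc _ ≤ 1 * |f e| := by gcongr; exact exp_discount_le_one r _
    _ ≤ C := by rw [one_mul]; exact hC e

lemma measurable_value_add_surplus (k V : ℝ≥0 →ᵇ ℝ) (q : ℝ≥0 → ℝ) (y : ℝ≥0) :
    Measurable fun e : ℝ × I => V (y + e.1.toNNReal) +
      surplus q (k (y + e.1.toNNReal) + V 0 - V (y + e.1.toNNReal)) e.2 := by
  have h : Measurable fun e : ℝ × I =>
      (k (y + e.1.toNNReal) + V 0 - V (y + e.1.toNNReal), e.2) :=
    (by fun_prop : Continuous fun e : ℝ × I =>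
      (k (y + e.1.toNNReal) + V 0 - V (y + e.1.toNNReal), e.2)).measurable
  exact (by fun_prop : Continuous fun e : ℝ × I => V (y + e.1.toNNReal)).measurable.add
    ((measurable_surplus_uncurry q).comp h)

lemma abs_value_add_surplus_le (k V : ℝ≥0 →ᵇ ℝ) (q : ℝ≥0 → ℝ) (a : ℝ≥0) (u : I) :
    |V a + surplus q (k a + V 0 - V a) u| ≤ ‖V‖ + (‖k‖ + ‖V‖ + ‖V‖) := by
  have h1 := abs_le.1 (V.norm_coe_le_norm a)
  have h2 := abs_le.1 (V.norm_coe_le_norm 0)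
  have h3 := abs_le.1 (k.norm_coe_le_norm a)
  refine (abs_add_le _ _).trans (add_le_add (V.norm_coe_le_norm a) ?_)
  rw [abs_of_nonneg (surplus_nonneg _ _)]
  exact (surplus_le _ _).trans (max_le (by linarith) (by positivity))

lemma integral_value_add_surplus (r : Rates) (k V : ℝ≥0 →ᵇ ℝ) (q : ℝ≥0 → ℝ) (y : ℝ≥0) :
    ∫ e, Real.exp (-(r.γ * e.1.toNNReal)) * (V (y + e.1.toNNReal) +
      surplus q (k (y + e.1.toNNReal) + V 0 - V (y + e.1.toNNReal)) e.2) ∂(auctionLaw r) =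
      discounted r (auctionValue k q V) y := by
  rw [auctionLaw, integral_prod _ (integrable_auctionLaw_discount r
    (measurable_value_add_surplus k V q y) fun e => abs_value_add_surplus_le k V q _ e.2),
    discounted_apply]
  refine integral_congr_ae (ae_of_all _ fun s => ?_)
  simp only
  rw [integral_const_mul, integral_add (integrable_const _) (integrable_surplus _ _),
    auctionValue_apply, integral_const, probReal_univ, one_smul]
  rfl

lemma measurable_auctionProfit_add (k V : ℝ≥0 →ᵇ ℝ) (q : ℝ≥0 → ℝ) (hπ : Measurable π) :
    Measurable fun p : ℝ≥0 × (ℝ × I) => auctionProfit k q π p.1 p.2 + V (nextState q π p.1 p.2) :=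
  (measurable_auctionProfit k.continuous.measurable q hπ).add
    (V.continuous.measurable.comp (measurable_nextState q hπ))

lemma abs_auctionProfit_add_le (V : ℝ≥0 →ᵇ ℝ) (hB : ∀ u, (priceToBeat q u).toReal ≤ B) (y : ℝ≥0)
    (e : ℝ × I) : |auctionProfit k q π y e + V (nextState q π y e)| ≤ ‖k‖ + B + ‖V‖ :=
  (abs_add_le _ _).trans (add_le_add (abs_auctionProfit_le hB y e) (V.norm_coe_le_norm _))

lemma integral_auctionProfit_add_le (V : ℝ≥0 →ᵇ ℝ) (hπ : Measurable π)
    (hB : ∀ u, (priceToBeat q u).toReal ≤ B) (y : ℝ≥0) :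
    ∫ e, Real.exp (-(r.γ * e.1.toNNReal)) * (auctionProfit k q π y e + V (nextState q π y e))
      ∂(auctionLaw r) ≤ discounted r (auctionValue k q V) y := by
  have hm : Measurable fun e => auctionProfit k q π y e + V (nextState q π y e) := by
    have h := (measurable_auctionProfit_add k V q hπ).comp (measurable_prodMk_left (x := y))
    simpa only [Function.comp_def] using h
  rw [← integral_value_add_surplus]
  refine integral_mono (integrable_auctionLaw_discount r hm
      fun e => abs_auctionProfit_add_le V hB y e) (integrable_auctionLaw_discount r
    (measurable_value_add_surplus k V q y) fun e => abs_value_add_surplus_le k V q _ e.2)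
    fun e => ?_
  exact mul_le_mul_of_nonneg_left (auctionProfit_add_le V y e) (Real.exp_nonneg _)

lemma integral_auctionProfit_add_eq (V : ℝ≥0 →ᵇ ℝ) (y : ℝ≥0) :
    ∫ e, Real.exp (-(r.γ * e.1.toNNReal)) * (auctionProfit k q (bellmanBid k V) y e +
      V (nextState q (bellmanBid k V) y e)) ∂(auctionLaw r) =
      discounted r (auctionValue k q V) y := by
  simp only [← integral_value_add_surplus, auctionProfit_add_eq]

/-- The expected discounted profit in the `n`-th auction. -/
def discountedProfit (r : Rates) (k q : ℝ≥0 → ℝ) (π : ℝ≥0 → ℝ≥0) (τ : ℝ≥0) (n : ℕ) : ℝ :=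
  ∫ x, discountFactor r x (n + 1) * auctionProfit k q π (state q π τ x n) (x n) ∂(sequenceLaw r)

/-- The expected discounted value of the state after `n` auctions. -/
def discountedValue (r : Rates) (q : ℝ≥0 → ℝ) (π : ℝ≥0 → ℝ≥0) (V : ℝ≥0 → ℝ) (τ : ℝ≥0) (n : ℕ) :
    ℝ :=
  ∫ x, discountFactor r x n * V (state q π τ x n) ∂(sequenceLaw r)

lemma measurable_profit (k : ℝ≥0 →ᵇ ℝ) (q : ℝ≥0 → ℝ) (hπ : Measurable π) (τ : ℝ≥0) (n : ℕ) :
    Measurable fun x : ℕ → ℝ × I => auctionProfit k q π (state q π τ x n) (x n) := by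
  have h : Measurable fun x : ℕ → ℝ × I => (state q π τ x n, x n) :=
    (measurable_state q hπ τ n).prodMk (measurable_pi_apply n)
  have h' := (measurable_auctionProfit k.continuous.measurable q hπ).comp h
  simpa only [Function.comp_def] using h'

lemma measurable_value (V : ℝ≥0 →ᵇ ℝ) (q : ℝ≥0 → ℝ) (hπ : Measurable π) (τ : ℝ≥0) (n : ℕ) :
    Measurable fun x : ℕ → ℝ × I => V (state q π τ x n) :=
  V.continuous.measurable.comp (measurable_state q hπ τ n)

/-- One step of dynamic programming: conditioning on the past isolates the inner integral, to be
compared with the Bellman operator at the current state. -/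
lemma discountedProfit_add_discountedValue (V : ℝ≥0 →ᵇ ℝ) (hπ : Measurable π)
    (hB : ∀ u, (priceToBeat q u).toReal ≤ B) (τ : ℝ≥0) (n : ℕ) :
    discountedProfit r k q π τ n + discountedValue r q π V τ (n + 1) =
      ∫ x, discountFactor r x n * ∫ e, Real.exp (-(r.γ * e.1.toNNReal)) *
        (auctionProfit k q π (state q π τ x n) e + V (nextState q π (state q π τ x n) e))
          ∂(auctionLaw r) ∂(sequenceLaw r) := by
  rw [← integral_discountFactor_mul r q hπ τ n (C := ‖k‖ + B + ‖V‖)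
    (F := fun p => Real.exp (-(r.γ * p.2.1.toNNReal)) *
      (auctionProfit k q π p.1 p.2 + V (nextState q π p.1 p.2)))]
  · rw [discountedProfit, discountedValue, ← integral_add
      (integrable_discountFactor_mul r (n + 1) (measurable_profit k q hπ τ n)
        fun x => abs_auctionProfit_le hB _ _)
      (integrable_discountFactor_mul r (n + 1) (measurable_value V q hπ τ (n + 1))
        fun x => V.norm_coe_le_norm _)]
    refine integral_congr_ae (ae_of_all _ fun x => ?_)
    simp only [discountFactor, state]
    ring
  · exact (by fun_prop : Measurable fun p : ℝ≥0 × (ℝ × I) =>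
      Real.exp (-(r.γ * p.2.1.toNNReal))).mul (measurable_auctionProfit_add k V q hπ)
  · intro p
    rw [abs_mul, Real.abs_exp]
    calc _ ≤ 1 * |auctionProfit k q π p.1 p.2 + V (nextState q π p.1 p.2)| := by
          gcongr; exact exp_discount_le_one r _
      _ ≤ _ := by rw [one_mul]; exact abs_auctionProfit_add_le V hB _ _

lemma abs_integral_discountFactor_mul_le (r : Rates) (n : ℕ) {g : (ℕ → ℝ × I) → ℝ} {C : ℝ}
    (hC : ∀ x, |g x| ≤ C) :
    |∫ x, discountFactor r x n * g x ∂(sequenceLaw r)| ≤ C * (r.μ / (r.μ + r.γ)) ^ n := by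
  have h := integrable_discountFactor_mul r n (g := fun _ => C) measurable_const fun _ => le_rfl
  have := norm_integral_le_of_norm_le (f := fun x => discountFactor r x n * g x) h
    (ae_of_all _ fun x => by
      rw [norm_mul, Real.norm_eq_abs, abs_of_nonneg (discountFactor_nonneg r x n)]
      exact mul_le_mul_of_nonneg_left (hC x) (discountFactor_nonneg r x n))
  rw [integral_mul_const, integral_discountFactor] at this
  rw [mul_comm C]
  exact this

lemma tendsto_discountedValue (V : ℝ≥0 →ᵇ ℝ) :
    Tendsto (discountedValue r q π V τ) atTop (𝓝 0) := by
  refine squeeze_zero_norm (fun n => abs_integral_discountFactor_mul_le r n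
    fun x => V.norm_coe_le_norm (state q π τ x n)) ?_
  simpa using (tendsto_pow_atTop_nhds_zero_of_lt_one (contraction_factor_nonneg r)
    (contraction_factor_lt_one r)).const_mul ‖V‖

lemma summable_discountedProfit (hB : ∀ u, (priceToBeat q u).toReal ≤ B) :
    Summable (discountedProfit r k q π τ) := by
  refine Summable.of_norm_bounded (((summable_geometric_of_lt_one (contraction_factor_nonneg r)
    (contraction_factor_lt_one r)).mul_left ((‖k‖ + B) * (r.μ / (r.μ + r.γ))))) fun n => ?_
  refine (abs_integral_discountFactor_mul_le r (n + 1)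
    fun x => abs_auctionProfit_le hB (state q π τ x n) (x n)).trans_eq ?_
  rw [pow_succ]
  ring

lemma discountedValue_zero (V : ℝ≥0 → ℝ) : discountedValue r q π V τ 0 = V τ := by
  simp [discountedValue, discountFactor, state]

/-- Telescoping. For a solution V of the Bellman equation each bracket is nonpositive, and zero
under `bellmanBid`. -/
lemma sum_discountedProfit (V : ℝ≥0 → ℝ) (n : ℕ) :
    ∑ i ∈ Finset.range n, discountedProfit r k q π τ i =
      V τ - discountedValue r q π V τ n + ∑ i ∈ Finset.range n, (discountedProfit r k q π τ i +
        discountedValue r q π V τ (i + 1) - discountedValue r q π V τ i) := by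
  induction n with
  | zero => simp [discountedValue_zero]
  | succ n ih => rw [Finset.sum_range_succ, Finset.sum_range_succ, ih]; ring

variable {V : ℝ≥0 →ᵇ ℝ}

lemma tsum_discountedProfit_le (hV : discounted r (auctionValue k q V) = V) (hπ : Measurable π)
    (hB : ∀ u, (priceToBeat q u).toReal ≤ B) : ∑' n, discountedProfit r k q π τ n ≤ V τ := by
  have hlim := (tendsto_discountedValue (r := r) (q := q) (π := π) (τ := τ) V).const_sub (V τ)
  rw [sub_zero] at hlim
  refine le_of_tendsto_of_tendsto' (summable_discountedProfit hB).hasSum.tendsto_sum_nat hlim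
    fun n => ?_
  rw [sum_discountedProfit V n]
  refine add_le_of_nonpos_right (Finset.sum_nonpos fun i _ => ?_)
  rw [discountedProfit_add_discountedValue V hπ hB, sub_nonpos, discountedValue]
  have hG : Measurable fun y => ∫ e, Real.exp (-(r.γ * e.1.toNNReal)) *
      (auctionProfit k q π y e + V (nextState q π y e)) ∂(auctionLaw r) := by
    have hF : Measurable fun p : ℝ≥0 × (ℝ × I) => Real.exp (-(r.γ * p.2.1.toNNReal)) *
        (auctionProfit k q π p.1 p.2 + V (nextState q π p.1 p.2)) :=
      (by fun_prop : Measurable fun p : ℝ≥0 × (ℝ × I) =>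
        Real.exp (-(r.γ * p.2.1.toNNReal))).mul (measurable_auctionProfit_add k V q hπ)
    exact (hF.stronglyMeasurable.integral_prod_right' (ν := auctionLaw r)).measurable
  have hGle : ∀ y, |∫ e, Real.exp (-(r.γ * e.1.toNNReal)) *
      (auctionProfit k q π y e + V (nextState q π y e)) ∂(auctionLaw r)| ≤ ‖k‖ + B + ‖V‖ := by
    intro y
    have h := norm_integral_le_of_norm_le_const (μ := auctionLaw r) (C := ‖k‖ + B + ‖V‖)
      (f := fun e => Real.exp (-(r.γ * e.1.toNNReal)) *
        (auctionProfit k q π y e + V (nextState q π y e))) (ae_of_all _ fun e => by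
          rw [norm_mul, Real.norm_eq_abs, Real.abs_exp]
          exact (mul_le_of_le_one_left (norm_nonneg _) (exp_discount_le_one r _)).trans
            (abs_auctionProfit_add_le V hB y e))
    simpa only [probReal_univ, mul_one, Real.norm_eq_abs] using h
  have hGm : Measurable fun x => ∫ e, Real.exp (-(r.γ * e.1.toNNReal)) *
      (auctionProfit k q π (state q π τ x i) e + V (nextState q π (state q π τ x i) e))
        ∂(auctionLaw r) := by
    have h := hG.comp (measurable_state q hπ τ i)
    simpa only [Function.comp_def] using h
  refine integral_mono (integrable_discountFactor_mul r i hGm fun x => hGle _)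
    (integrable_discountFactor_mul r i (measurable_value V q hπ τ i)
      fun x => V.norm_coe_le_norm _) fun x => ?_
  refine mul_le_mul_of_nonneg_left ?_ (discountFactor_nonneg r x i)
  have h := integral_auctionProfit_add_le (r := r) (k := k) V hπ hB (state q π τ x i)
  rwa [hV] at h

lemma tsum_discountedProfit_eq (hV : discounted r (auctionValue k q V) = V)
    (hB : ∀ u, (priceToBeat q u).toReal ≤ B) :
    ∑' n, discountedProfit r k q (bellmanBid k V) τ n = V τ := by
  have hlim := (tendsto_discountedValue (r := r) (q := q) (π := bellmanBid k V) (τ := τ)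
    V).const_sub (V τ)
  rw [sub_zero] at hlim
  refine tendsto_nhds_unique (summable_discountedProfit hB).hasSum.tendsto_sum_nat ?_
  refine hlim.congr fun n => ?_
  rw [sum_discountedProfit V n]
  refine (add_eq_left.2 (Finset.sum_eq_zero fun i _ => ?_)).symm
  rw [discountedProfit_add_discountedValue V (measurable_bellmanBid k V) hB, sub_eq_zero,
    discountedValue]
  simp only [integral_auctionProfit_add_eq, hV]

end verification

/-! ### The expected payoff -/

section payoff

variable {r : Rates} {k : ℝ≥0 →ᵇ ℝ} {q : ℝ≥0 → ℝ} {π : ℝ≥0 → ℝ≥0} {τ : ℝ≥0} {B : ℝ}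

lemma ae_sequenceLaw_nonneg (r : Rates) : ∀ᵐ x ∂(sequenceLaw r), ∀ n, 0 ≤ (x n).1 := by
  rw [ae_all_iff]
  intro n
  have h1 : ∀ᵐ e ∂(auctionLaw r), 0 ≤ e.1 :=
    (Measure.quasiMeasurePreserving_fst (μ := expMeasure r.μ) (ν := (volume : Measure I))).ae
      (ae_nonneg_expMeasure r.μ)
  exact (measurePreserving_eval_infinitePi (fun _ : ℕ => auctionLaw r) n).quasiMeasurePreserving.ae
    h1

lemma discountFactor_eq_exp {x : ℕ → ℝ × I} (hx : ∀ n, 0 ≤ (x n).1) (n : ℕ) :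
    discountFactor r x n = Real.exp (-(r.γ * ∑ j ∈ Finset.range n, (x j).1)) := by
  induction n with
  | zero => simp [discountFactor]
  | succ n ih =>
    rw [discountFactor, ih, Finset.sum_range_succ, ← Real.exp_add, Real.coe_toNNReal _ (hx n)]
    ring_nf

lemma measurable_arrivalTime (n : ℕ) : Measurable fun ω : Sample => arrivalTime ω n := by
  unfold arrivalTime
  fun_prop

open Classical in
lemma measurable_ite_arrivalTime (n : ℕ) {g : (ℕ → ℝ × I) → ℝ} (hg : Measurable g) :
    Measurable fun ω : Sample => if arrivalTime ω n ≤ ω.1 then g ω.2 else 0 :=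
  Measurable.ite (measurableSet_le (measurable_arrivalTime n) measurable_fst)
    (hg.comp measurable_snd) measurable_const

instance (r : Rates) : IsProbabilityMeasure (episodeLaw r) :=
  inferInstanceAs (IsProbabilityMeasure ((expMeasure r.γ).prod (sequenceLaw r)))

open Classical in
lemma integrable_ite_arrivalTime (r : Rates) (n : ℕ) {g : (ℕ → ℝ × I) → ℝ} (hg : Measurable g)
    {C : ℝ} (hC : ∀ x, |g x| ≤ C) :
    Integrable (fun ω : Sample => if arrivalTime ω n ≤ ω.1 then g ω.2 else 0) (episodeLaw r) := by
  refine Integrable.of_bound (C := C) (measurable_ite_arrivalTime n hg).aestronglyMeasurable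
    (ae_of_all _ fun ω => ?_)
  split_ifs
  · exact hC _
  · rw [norm_zero]
    exact (abs_nonneg _).trans (hC ω.2)

open Classical in
/-- Integrating out the length of the episode produces the discount. -/
lemma integral_ite_arrivalTime (r : Rates) (n : ℕ) {g : (ℕ → ℝ × I) → ℝ} (hg : Measurable g)
    {C : ℝ} (hC : ∀ x, |g x| ≤ C) :
    ∫ ω, (if arrivalTime ω n ≤ ω.1 then g ω.2 else 0) ∂(episodeLaw r) =
      ∫ x, discountFactor r x (n + 1) * g x ∂(sequenceLaw r) := by
  have hi := integrable_ite_arrivalTime r n hg hC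
  change Integrable _ ((expMeasure r.γ).prod (sequenceLaw r)) at hi
  change ∫ ω, _ ∂((expMeasure r.γ).prod (sequenceLaw r)) = _
  rw [integral_prod_symm _ hi]
  refine integral_congr_ae ?_
  -- Nonnegativity is needed because the discount truncates interarrival times at zero while arrival
  -- times do not. Auctions are numbered from 0, hence the discount index n + 1.
  filter_upwards [ae_sequenceLaw_nonneg r] with x hx
  rw [discountFactor_eq_exp hx, ← measureReal_expMeasure_Ici r.γ_pos
    (Finset.sum_nonneg fun j _ => hx j), ← integral_indicator_one measurableSet_Ici,
    ← integral_mul_const]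
  refine integral_congr_ae (ae_of_all _ fun l => ?_)
  by_cases h : ∑ j ∈ Finset.range (n + 1), (x j).1 ≤ l <;> simp [arrivalTime, h]

open Classical in
lemma episodeProfit_eq (k q : ℝ≥0 → ℝ) (π : ℝ≥0 → ℝ≥0) (τ : ℝ≥0) (ω : Sample) :
    episodeProfit k q π τ ω = ∑' n, if arrivalTime ω n ≤ ω.1 then
      auctionProfit k q π (state q π τ ω.2 n) (ω.2 n) else 0 := by
  unfold episodeProfit
  refine tsum_congr fun n => ?_
  rw [age_eq_state, ite_and]
  rfl

lemma expectedPayoff_eq_tsum (hπ : Measurable π) (hB : ∀ u, (priceToBeat q u).toReal ≤ B) :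
    expectedPayoff r k q π τ = ∑' n, discountedProfit r k q π τ n := by
  classical
  have hm := measurable_profit k q hπ τ
  have hb : ∀ n (x : ℕ → ℝ × I), |auctionProfit k q π (state q π τ x n) (x n)| ≤ ‖k‖ + B :=
    fun n x => abs_auctionProfit_le hB _ _
  have h := hasSum_integral_of_summable_integral_norm (μ := episodeLaw r)
    (F := fun n (ω : Sample) => if arrivalTime ω n ≤ ω.1 then
      auctionProfit k q π (state q π τ ω.2 n) (ω.2 n) else 0)
    (fun n => integrable_ite_arrivalTime r n (hm n) (hb n)) ?_
  · simp only [expectedPayoff, episodeProfit_eq]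
    rw [← h.tsum_eq]
    exact tsum_congr fun n => integral_ite_arrivalTime r n (hm n) (hb n)
  · refine Summable.of_norm_bounded (((summable_geometric_of_lt_one (contraction_factor_nonneg r)
      (contraction_factor_lt_one r)).mul_left ((‖k‖ + B) * (r.μ / (r.μ + r.γ))))) fun n => ?_
    have hb' : ∀ x : ℕ → ℝ × I, |(|auctionProfit k q π (state q π τ x n) (x n)|)| ≤ ‖k‖ + B :=
      fun x => by rw [abs_abs]; exact hb n x
    -- The same discount formula, applied to the absolute profit, gives the geometric bound that
    -- allows exchanging sum and expectation.
    have h1 := integral_ite_arrivalTime r n (hm n).abs hb'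
    have h2 := abs_integral_discountFactor_mul_le r (n + 1) hb'
    rw [← h1] at h2
    rw [Real.norm_eq_abs]
    refine (le_of_eq ?_).trans (h2.trans_eq (by rw [pow_succ]; ring))
    congr 1
    refine integral_congr_ae (ae_of_all _ fun ω => ?_)
    simp only
    split_ifs <;> simp

variable {V : ℝ≥0 →ᵇ ℝ}

lemma expectedPayoff_le (hV : discounted r (auctionValue k q V) = V) (hπ : Measurable π)
    (hB : ∀ u, (priceToBeat q u).toReal ≤ B) : expectedPayoff r k q π τ ≤ V τ := by
  rw [expectedPayoff_eq_tsum hπ hB]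
  exact tsum_discountedProfit_le hV hπ hB

lemma expectedPayoff_bellmanBid (hV : discounted r (auctionValue k q V) = V)
    (hB : ∀ u, (priceToBeat q u).toReal ≤ B) :
    expectedPayoff r k q (bellmanBid k V) τ = V τ := by
  rw [expectedPayoff_eq_tsum (measurable_bellmanBid k V) hB]
  exact tsum_discountedProfit_eq hV hB

lemma bellmanValue_eq (hV : discounted r (auctionValue k q V) = V)
    (hB : ∀ u, (priceToBeat q u).toReal ≤ B) (τ : ℝ≥0) : bellmanValue r k q τ = V τ := by
  have hle : ∀ π : {π : ℝ≥0 → ℝ≥0 // Measurable π}, expectedPayoff r k q π τ ≤ V τ :=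
    fun π => expectedPayoff_le hV π.2 hB
  have : Nonempty {π : ℝ≥0 → ℝ≥0 // Measurable π} := ⟨⟨_, measurable_bellmanBid k V⟩⟩
  refine le_antisymm (ciSup_le hle) ?_
  rw [← expectedPayoff_bellmanBid hV hB]
  exact le_ciSup (f := fun π : {π : ℝ≥0 → ℝ≥0 // Measurable π} => expectedPayoff r k q π τ)
    ⟨V τ, by rintro _ ⟨π, rfl⟩; exact hle π⟩ ⟨_, measurable_bellmanBid k V⟩

lemma optimalBid_eq (hV : discounted r (auctionValue k q V) = V)
    (hB : ∀ u, (priceToBeat q u).toReal ≤ B) : optimalBid r k q = bellmanBid k V := by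
  funext τ
  rw [optimalBid, bellmanValue_eq hV hB, bellmanValue_eq hV hB, bellmanBid]

lemma isOptimalPolicy_bellmanBid (hV : discounted r (auctionValue k q V) = V)
    (hB : ∀ u, (priceToBeat q u).toReal ≤ B) : IsOptimalPolicy r k q (bellmanBid k V) := by
  refine ⟨measurable_bellmanBid k V, fun π' hπ' τ => ?_⟩
  rw [expectedPayoff_bellmanBid hV hB]
  exact expectedPayoff_le hV hπ' hB

end payoff

/-! ### The environment classes -/

lemma continuous_of_isPiecewiseLinear {m : ℕ} {t : Fin (m + 1) → ℝ≥0} (ht : StrictMono t)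
    (ht0 : t 0 = 0) {f : ℝ≥0 → ℝ} (hf : IsPiecewiseLinear t f) : Continuous f := by
  have hlin : ∀ (s : Set ℝ≥0) (a c : ℝ), (∀ x ∈ s, f x = a * x + c) → ContinuousOn f s := by
    intro s a c h
    refine ContinuousOn.congr (f := fun x : ℝ≥0 => a * (x : ℝ) + c) ?_ h
    exact (by fun_prop : Continuous fun x : ℝ≥0 => a * (x : ℝ) + c).continuousOn
  have hIcc : ∀ i, ContinuousOn f (Icc 0 (t i)) := by
    intro i
    induction i using Fin.induction with
    | zero => rw [ht0, Icc_self]; exact continuousOn_singleton _ _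
    | succ i ih =>
      obtain ⟨a, c, h⟩ := hf.1 i
      have h2 := ih.union_of_isClosed (hlin _ a c h) isClosed_Icc isClosed_Icc
      rwa [Icc_union_Icc_eq_Icc zero_le (ht i.castSucc_lt_succ).le] at h2
  obtain ⟨a, c, h⟩ := hf.2
  have h2 := (hIcc (Fin.last m)).union_of_isClosed (hlin (Ici (t (Fin.last m))) a c h)
    isClosed_Icc isClosed_Ici
  rw [Icc_union_Ici_eq_Ici zero_le] at h2
  rw [← continuousOn_univ]
  convert h2 using 1
  exact (eq_univ_of_forall fun x : ℝ≥0 => (zero_le : 0 ≤ x)).symm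

/-- A function of the class of win probabilities is constant after the last breakpoint. -/
lemma winProbClass_const {n : ℕ} {b : Fin (n + 1) → ℝ≥0} {q : ℝ≥0 → ℝ} (hq : q ∈ winProbClass b)
    {x : ℝ≥0} (hx : b (Fin.last n) ≤ x) : q x = q (b (Fin.last n)) := by
  obtain ⟨⟨-, a, c, h⟩, hmono, -, h1⟩ := hq
  -- A positive slope on the unbounded last piece would push q above 1.
  have hle : a ≤ 0 := by
    by_contra! ha
    obtain ⟨N, hN⟩ := exists_nat_gt ((1 - c) / a)
    rw [div_lt_iff₀ ha] at hN
    have h2 := h1 (b (Fin.last n) + N)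
    rw [h _ le_self_add] at h2
    push_cast at h2
    have := mul_nonneg ha.le (b (Fin.last n)).coe_nonneg
    nlinarith
  refine le_antisymm ?_ (hmono hx)
  rw [h x hx, h _ le_rfl]
  have : ((b (Fin.last n) : ℝ≥0) : ℝ) ≤ x := hx
  nlinarith

/-- Since q is constant past the last breakpoint, any level exceeded at all is exceeded there;
infinite prices contribute 0. This bound makes all profits bounded. -/
lemma priceToBeat_toReal_le {n : ℕ} {b : Fin (n + 1) → ℝ≥0} {q : ℝ≥0 → ℝ}
    (hq : q ∈ winProbClass b) (u : I) : (priceToBeat q u).toReal ≤ b (Fin.last n) := by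
  by_cases h : ∃ x, (u : ℝ) < q x
  · obtain ⟨x, hx⟩ := h
    have hu : (u : ℝ) < q (b (Fin.last n)) := by
      rcases le_total (b (Fin.last n)) x with h | h
      · rwa [← winProbClass_const hq h]
      · exact hx.trans_le (hq.2.1 h)
    have h2 : priceToBeat q u ≤ (b (Fin.last n) : ℝ≥0∞) := iInf₂_le (b (Fin.last n)) hu
    simpa using ENNReal.toReal_mono ENNReal.coe_ne_top h2
  · push Not at h
    have : priceToBeat q u = ⊤ := by
      simp [priceToBeat, h]
    simp [this]

lemma exists_boundedContinuousFunction {m : ℕ} {t : Fin (m + 1) → ℝ≥0} (ht : StrictMono t)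
    (ht0 : t 0 = 0) {k : ℝ≥0 → ℝ} (hk : k ∈ rewardClass t) : ∃ f : ℝ≥0 →ᵇ ℝ, ⇑f = k := by
  refine ⟨BoundedContinuousFunction.ofNormedAddCommGroup k
    (continuous_of_isPiecewiseLinear ht ht0 hk.1) (|k 0| + |k (t (Fin.last m))|) fun x => ?_, rfl⟩
  have h1 : k 0 ≤ k x := hk.2.2.1 zero_le
  have h2 : k x ≤ k (t (Fin.last m)) := by
    rcases le_total (t (Fin.last m)) x with h | h
    · exact (hk.2.2.2 x h).le
    · exact hk.2.2.1 h
  rw [Real.norm_eq_abs, abs_le]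
  constructor
  · linarith [neg_abs_le (k 0), abs_nonneg (k (t (Fin.last m)))]
  · linarith [le_abs_self (k (t (Fin.last m))), abs_nonneg (k 0)]

/-! ### Properties of the Bellman value -/

/-- Value iteration as a proof principle: an upper bound that improves itself by a factor c < 1
tends to zero. It yields inequalities for the Bellman solution directly. -/
lemma nonpos_of_contracting {ι : Type*} {F : ι → ℝ} {c C : ℝ} (hc0 : 0 ≤ c) (hc1 : c < 1)
    (hC : 0 ≤ C) (hF : ∀ i, F i ≤ C)
    (step : ∀ δ, 0 ≤ δ → (∀ i, F i ≤ δ) → ∀ i, F i ≤ c * δ) (i : ι) : F i ≤ 0 := by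
  have h : ∀ n : ℕ, ∀ i, F i ≤ c ^ n * C := by
    intro n
    induction n with
    | zero => simpa using hF
    | succ n ih =>
      intro i
      rw [pow_succ', mul_assoc]
      exact step _ (by positivity) ih i
  have hlim := (tendsto_pow_atTop_nhds_zero_of_lt_one hc0 hc1).mul_const C
  rw [zero_mul] at hlim
  exact ge_of_tendsto' hlim fun n => h n i

/-- The bid before truncation at zero, at elapsed time `a`. -/
def willingness (k V : ℝ≥0 →ᵇ ℝ) (a : ℝ≥0) : ℝ := k a + V 0 - V a

section value

variable {r : Rates} {k : ℝ≥0 →ᵇ ℝ} {q : ℝ≥0 → ℝ} {V : ℝ≥0 →ᵇ ℝ} {T : ℝ≥0}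

lemma value_eq_of_le (hV : discounted r (auctionValue k q V) = V) (hk : ∀ x, T ≤ x → k x = k T)
    {x : ℝ≥0} (hx : T ≤ x) : V x = V T := by
  -- Indexing by pairs bounds the oscillation of V beyond T, which one Bellman step contracts.
  have key : ∀ p : ℝ≥0 × ℝ≥0, V (T + p.1) - V (T + p.2) ≤ 0 := by
    refine nonpos_of_contracting (contraction_factor_nonneg r) (contraction_factor_lt_one r)
      (C := ‖V‖ + ‖V‖) (by positivity) (fun p => ?_) fun δ hδ ih p => ?_
    · have h1 := abs_le.1 (V.norm_coe_le_norm (T + p.1))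
      have h2 := abs_le.1 (V.norm_coe_le_norm (T + p.2))
      linarith
    · have h := discounted_le_add r (g := auctionValue k q V) (h := auctionValue k q V)
        (x := T + p.1) (y := T + p.2) (δ := δ) fun s => by
          rw [auctionValue_apply, auctionValue_apply, add_assoc, add_assoc T p.2 s,
            hk _ le_self_add, hk (T + (p.2 + s)) le_self_add]
          have h1 := ih (p.1 + s, p.2 + s)
          have h2 := add_meanSurplus_le (q := q) (z := k T) (v := V (T + (p.1 + s)))
            (v' := V (T + (p.2 + s)) + δ) (w := V 0) (w' := V 0 + δ) (by linarith) (by linarith)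
          have e : k T + (V 0 + δ) - (V (T + (p.2 + s)) + δ) = k T + V 0 - V (T + (p.2 + s)) := by
            ring
          rw [e] at h2
          linarith
      rw [hV] at h
      linarith
  obtain ⟨y, rfl⟩ := exists_add_of_le hx
  have h1 := key (y, 0)
  have h2 := key (0, y)
  simp only [add_zero] at h1 h2
  linarith

lemma value_at_last (hV : discounted r (auctionValue k q V) = V) (hk : ∀ x, T ≤ x → k x = k T) :
    r.γ * V T = r.μ * meanSurplus q (willingness k V T) := by
  have h : discounted r (auctionValue k q V) T =
      r.μ / (r.μ + r.γ) * (V T + meanSurplus q (willingness k V T)) := by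
    rw [discounted_apply, ← integral_discount, ← integral_mul_const]
    refine integral_congr_ae (ae_of_all _ fun s => ?_)
    simp only
    rw [auctionValue_apply, willingness, hk _ le_self_add, value_eq_of_le hV hk le_self_add]
  have hpos := add_pos r.μ_pos r.γ_pos
  rw [hV] at h
  field_simp at h
  linarith

lemma willingness_le_last (hV : discounted r (auctionValue k q V) = V)
    (hk : ∀ x, T ≤ x → k x = k T) (hmono : Monotone k) (x : ℝ≥0) :
    willingness k V x ≤ willingness k V T := by
  have hkT : ∀ x, k x ≤ k T := fun x => by
    rcases le_total T x with h | h
    · exact (hk x h).le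
    · exact hmono h
  -- Starting at T rather than at x is worth at most k(T) - k(x): that is the most a single reward
  -- can gain, and a win resets both processes.
  have key : ∀ x, V T - (k T - k x) - V x ≤ 0 := by
    refine nonpos_of_contracting (contraction_factor_nonneg r) (contraction_factor_lt_one r)
      (C := ‖V‖ + ‖V‖) (by positivity) (fun x => ?_) fun δ hδ ih x => ?_
    · have h1 := abs_le.1 (V.norm_coe_le_norm T)
      have h2 := abs_le.1 (V.norm_coe_le_norm x)
      have := hkT x
      linarith
    · have h := discounted_le_add r (g := auctionValue k q V) (h := auctionValue k q V)
        (x := T) (y := x) (δ := k T - k x + δ) fun s => by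
          rw [auctionValue_apply, auctionValue_apply, hk _ le_self_add,
            value_eq_of_le hV hk le_self_add]
          have h1 := ih (x + s)
          -- Adding the reward deficit to the value of a loss has the same effect on the willingness
          -- to pay as lowering the reward from k(T) to k(x + s).
          have h2 := add_meanSurplus_le (q := q) (z := k T) (v := V T)
            (v' := V (x + s) + (k T - k (x + s)) + δ) (w := V 0) (w' := V 0 + δ)
            (by linarith) (by linarith)
          have e : k T + (V 0 + δ) - (V (x + s) + (k T - k (x + s)) + δ) =
            k (x + s) + V 0 - V (x + s) := by ring
          rw [e] at h2
          have h3 : k x ≤ k (x + s) := hmono le_self_add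
          linarith
      rw [hV] at h
      have h4 := mul_le_mul_of_nonneg_right (contraction_factor_lt_one r).le
        (sub_nonneg.2 (hkT x))
      linarith
  have := key x
  unfold willingness
  linarith

lemma integrableOn_exp_mul {c : ℝ} (hc : 0 < c) (g : ℝ≥0 →ᵇ ℝ) :
    IntegrableOn (fun a : ℝ => Real.exp (-c * a) * g a.toNNReal) (Ioi 0) := by
  have hcont : Continuous fun a : ℝ => g a.toNNReal := by fun_prop
  exact (exp_neg_integrableOn_Ioi 0 hc).mul_bdd (c := ‖g‖) hcont.aestronglyMeasurable
    (ae_of_all _ fun a => g.norm_coe_le_norm _)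

/-- Substituting a = x + s moves x out of the integrand into a prefactor and an endpoint, so
differentiability in x needs only continuity of g. -/
lemma discounted_eq_exp_mul (r : Rates) (g : ℝ≥0 →ᵇ ℝ) {x : ℝ} (hx : 0 ≤ x) :
    discounted r g x.toNNReal = r.μ * Real.exp ((r.μ + r.γ) * x) *
      ((∫ a in Ioi 0, Real.exp (-(r.μ + r.γ) * a) * g a.toNNReal) -
        ∫ a in 0..x, Real.exp (-(r.μ + r.γ) * a) * g a.toNNReal) := by
  have hint := integrableOn_exp_mul (add_pos r.μ_pos r.γ_pos) g
  have hsplit : (∫ a in Ioi 0, Real.exp (-(r.μ + r.γ) * a) * g a.toNNReal) -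
      ∫ a in 0..x, Real.exp (-(r.μ + r.γ) * a) * g a.toNNReal =
      ∫ a in Ioi x, Real.exp (-(r.μ + r.γ) * a) * g a.toNNReal := by
    rw [← intervalIntegral.integral_Ioi_sub_Ioi hint hx, sub_sub_cancel]
  have hshift := (measurePreserving_add_left volume x).setIntegral_preimage_emb
    (measurableEmbedding_addLeft x)
    (fun a => r.μ * Real.exp ((r.μ + r.γ) * x) * (Real.exp (-(r.μ + r.γ) * a) * g a.toNNReal))
    (Ioi x)
  rw [preimage_const_add_Ioi, sub_self] at hshift
  rw [hsplit, discounted_apply, integral_expMeasure r.μ_pos, ← integral_const_mul, ← hshift]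
  refine setIntegral_congr_fun measurableSet_Ioi fun s hs => ?_
  have hs' : 0 ≤ s := le_of_lt hs
  have e : Real.exp (-(r.μ * s)) * Real.exp (-(r.γ * s)) =
      Real.exp ((r.μ + r.γ) * x) * Real.exp (-(r.μ + r.γ) * (x + s)) := by
    rw [← Real.exp_add, ← Real.exp_add]
    ring_nf
  rw [Real.toNNReal_add hx hs', Real.coe_toNNReal _ hs']
  linear_combination r.μ * g (x.toNNReal + s.toNNReal) * e

lemma hasDerivWithinAt_value (hV : discounted r (auctionValue k q V) = V) {x : ℝ} (hx : 0 ≤ x) :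
    HasDerivWithinAt (fun y : ℝ => V y.toNNReal)
      (r.γ * V x.toNNReal - r.μ * meanSurplus q (willingness k V x.toNNReal)) (Ici x) x := by
  set g := auctionValue k q V
  have hcont : Continuous fun a : ℝ => Real.exp (-(r.μ + r.γ) * a) * g a.toNNReal := by fun_prop
  have h1 : HasDerivAt (fun y => ∫ a in 0..y, Real.exp (-(r.μ + r.γ) * a) * g a.toNNReal)
      (Real.exp (-(r.μ + r.γ) * x) * g x.toNNReal) x :=
    hcont.integral_hasStrictDerivAt 0 x |>.hasDerivAt
  have h2 : HasDerivAt (fun y : ℝ => r.μ * Real.exp ((r.μ + r.γ) * y))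
      (r.μ * (Real.exp ((r.μ + r.γ) * x) * (r.μ + r.γ))) x := by
    have := (((hasDerivAt_id x).const_mul (r.μ + r.γ)).exp).const_mul r.μ
    simpa using this
  have h3 := h2.mul (h1.const_sub (∫ a in Ioi 0, Real.exp (-(r.μ + r.γ) * a) * g a.toNNReal))
  have hval : ∀ y : ℝ, 0 ≤ y → V y.toNNReal = r.μ * Real.exp ((r.μ + r.γ) * y) *
      ((∫ a in Ioi 0, Real.exp (-(r.μ + r.γ) * a) * g a.toNNReal) -
        ∫ a in 0..y, Real.exp (-(r.μ + r.γ) * a) * g a.toNNReal) := fun y hy => by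
    rw [← discounted_eq_exp_mul r g hy, hV]
  refine HasDerivWithinAt.congr_deriv (h3.hasDerivWithinAt.congr
    (fun y hy => hval y (hx.trans hy)) (hval x hx)) ?_
  have h4 := hval x hx
  have h5 : Real.exp ((r.μ + r.γ) * x) * Real.exp (-(r.μ + r.γ) * x) = 1 := by
    rw [← Real.exp_add, ← add_mul, add_neg_cancel, zero_mul, Real.exp_zero]
  have h6 : g x.toNNReal = V x.toNNReal + meanSurplus q (willingness k V x.toNNReal) := rfl
  -- The product rule gives (μ+γ) V - μ g, and g = V + S(w).
  linear_combination (-(r.μ + r.γ)) * h4 - r.μ * g x.toNNReal * h5 - r.μ * h6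

end value

/-- **Comparison of the asymptotic bids**, before truncation at zero. -/
lemma willingness_last_mono {r : Rates} {k₁ k₂ V₁ V₂ : ℝ≥0 →ᵇ ℝ} {q₁ q₂ : ℝ≥0 → ℝ} {T : ℝ≥0}
    (hV₁ : discounted r (auctionValue k₁ q₁ V₁) = V₁)
    (hV₂ : discounted r (auctionValue k₂ q₂ V₂) = V₂)
    (hk₁ : ∀ x, T ≤ x → k₁ x = k₁ T) (hk₂ : ∀ x, T ≤ x → k₂ x = k₂ T) (hmono : Monotone k₂)
    (hk : ∀ x, k₁ x ≤ k₂ x) (hq : ∀ x, q₂ x ≤ q₁ x) :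
    willingness k₁ V₁ T ≤ willingness k₂ V₂ T := by
  by_contra! hlt
  have hl₁ := value_at_last hV₁ hk₁
  have hl₂ := value_at_last hV₂ hk₂
  have hc : ∀ V : ℝ≥0 →ᵇ ℝ, ContinuousOn (fun y : ℝ => V y.toNNReal - V 0) (Icc 0 T) :=
    fun V => (by fun_prop : Continuous fun y : ℝ => V y.toNNReal - V 0).continuousOn
  -- Barrier argument: V₁ - V₁(0) stays above V₂ - V₂(0) because its right derivative is strictly
  -- larger at each contact point.
  have h := image_le_of_deriv_right_lt_deriv_boundary' (a := 0) (b := T)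
    (hc V₂) (fun x hx => (hasDerivWithinAt_value hV₂ hx.1).sub_const (V₂ 0)) (by simp)
    (hc V₁) (fun x hx => (hasDerivWithinAt_value hV₁ hx.1).sub_const (V₁ 0)) ?_
    (right_mem_Icc.2 T.coe_nonneg)
  · have := hk T
    simp only [Real.toNNReal_coe] at h
    unfold willingness at hlt
    linarith
  · intro x _ hx
    have hT := hk T
    have hx' := hk x.toNNReal
    have hu : willingness k₁ V₁ x.toNNReal ≤ willingness k₂ V₂ x.toNNReal := by
      unfold willingness; linarith
    have hs := meanSurplus_sub_le hq hu (willingness_le_last hV₂ hk₂ hmono x.toNNReal) hlt.le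
    have hs' := mul_le_mul_of_nonneg_left hs r.μ_pos.le
    have hpos : 0 < r.γ * (V₁ 0 - V₁ T - (V₂ 0 - V₂ T)) := by
      refine mul_pos r.γ_pos ?_
      unfold willingness at hlt
      linarith
    -- At a contact point, this and the values at T (`hl₁`, `hl₂`) reduce the difference of the
    -- derivatives to the surplus comparison plus the strictly positive term `hpos`.
    have hVx : V₁ x.toNNReal - V₂ x.toNNReal = V₁ 0 - V₂ 0 := by linarith
    have hVx' : r.γ * (V₁ x.toNNReal - V₂ x.toNNReal) = r.γ * (V₁ 0 - V₂ 0) := by rw [hVx]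
    linarith

lemma bellmanBid_tendsto {r : Rates} {k V : ℝ≥0 →ᵇ ℝ} {q : ℝ≥0 → ℝ} {T : ℝ≥0}
    (hV : discounted r (auctionValue k q V) = V) (hk : ∀ x, T ≤ x → k x = k T) :
    Tendsto (bellmanBid k V) atTop (𝓝 (willingness k V T).toNNReal) := by
  refine tendsto_const_nhds.congr' ?_
  filter_upwards [eventually_ge_atTop T] with x hx
  rw [bellmanBid, willingness, hk x hx, value_eq_of_le hV hk hx]

end RepeatedAuction

end

theorem mainTheorem5 (r : RepeatedAuction.Rates) {m n : ℕ}
    (t : Fin (m + 1) → ℝ≥0) (ht : StrictMono t) (ht0 : t 0 = 0)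
    (b : Fin (n + 1) → ℝ≥0) (hb : StrictMono b) (hb0 : b 0 = 0)
    (k₁ k₂ q₁ q₂ : ℝ≥0 → ℝ)
    (hk₁ : k₁ ∈ RepeatedAuction.rewardClass t) (hk₂ : k₂ ∈ RepeatedAuction.rewardClass t)
    (hq₁ : q₁ ∈ RepeatedAuction.winProbClass b) (hq₂ : q₂ ∈ RepeatedAuction.winProbClass b)
    (hk : ∀ τ, k₁ τ ≤ k₂ τ) (hq : ∀ x, q₂ x ≤ q₁ x) :
    RepeatedAuction.IsOptimalPolicy r k₁ q₁ (RepeatedAuction.optimalBid r k₁ q₁) ∧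
    RepeatedAuction.IsOptimalPolicy r k₂ q₂ (RepeatedAuction.optimalBid r k₂ q₂) ∧
    Tendsto (RepeatedAuction.optimalBid r k₁ q₁) atTop
      (𝓝 (RepeatedAuction.asymptoticBid (RepeatedAuction.optimalBid r k₁ q₁))) ∧
    Tendsto (RepeatedAuction.optimalBid r k₂ q₂) atTop
      (𝓝 (RepeatedAuction.asymptoticBid (RepeatedAuction.optimalBid r k₂ q₂))) ∧
    RepeatedAuction.asymptoticBid (RepeatedAuction.optimalBid r k₁ q₁) ≤
      RepeatedAuction.asymptoticBid (RepeatedAuction.optimalBid r k₂ q₂) := by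
  open RepeatedAuction in
  obtain ⟨k₁, rfl⟩ := exists_boundedContinuousFunction ht ht0 hk₁
  obtain ⟨k₂, rfl⟩ := exists_boundedContinuousFunction ht ht0 hk₂
  have hV₁ := bellmanSolution_eq r k₁ q₁
  have hV₂ := bellmanSolution_eq r k₂ q₂
  rw [optimalBid_eq hV₁ (priceToBeat_toReal_le hq₁), optimalBid_eq hV₂ (priceToBeat_toReal_le hq₂)]
  have ht₁ := bellmanBid_tendsto hV₁ hk₁.2.2.2
  have ht₂ := bellmanBid_tendsto hV₂ hk₂.2.2.2
  have e₁ := ht₁.limUnder_eq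
  have e₂ := ht₂.limUnder_eq
  refine ⟨isOptimalPolicy_bellmanBid hV₁ (priceToBeat_toReal_le hq₁),
    isOptimalPolicy_bellmanBid hV₂ (priceToBeat_toReal_le hq₂), ?_, ?_, ?_⟩
  · rwa [asymptoticBid, e₁]
  · rwa [asymptoticBid, e₂]
  · rw [asymptoticBid, asymptoticBid, e₁, e₂]
    exact Real.toNNReal_le_toNNReal (willingness_last_mono hV₁ hV₂ hk₁.2.2.2 hk₂.2.2.2
      hk₂.2.2.1 hk hq)
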